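/- Let $v\ge 1$ and let $\mathcal A_v$ be the real Cayley–Dickson algebra of dimension $2^v$, built from $\mathcal A_0=\mathbb R$ by the doubling $(a,b)(c,d)=(ac-d^*b,\;da+bc^*)$, $(a,b)^*=(a^*,-b)$, with the Euclidean norm $|\cdot|$ and $\exp(x)=\sum_{n\ge 0}x^n/n!$. Let $\Gamma$ be the Gamma function on $\mathcal A_v\setminus\{0,-1,-2,\dots\}$: $\Gamma(z)=\int_0^\infty e^{-t}\exp((z-1)\ln t)\,dt$ for $\mathrm{Re}\,z>0$, continued holomorphically within each complex plane $\mathbb R\oplus N\mathbb R$, where $N$ is purely imaginary with $|N|=1$; $1/\Gamma$ has the value $0$ at $0,-1,-2,\dots$. Let $M\in\mathcal A_v$ be purely imaginary with $|M|=1$, and let $\psi:\mathbb R\to(\mathbb R\oplus M\mathbb R)\setminus\{0\}$ be a continuous, locally rectifiable loop which starts at $-\infty$ on the real axis, encircles $0$ once in the positive direction and returns to $-\infty$: that is, $|\psi(t)|\to\infty$ as $t\to\pm\infty$, and $\psi(t)=|\psi(t)|e^{\theta(t)M}$ with a continuous argument $\theta$ such that $\theta(t)\to-\pi$ as $t\to-\infty$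 and $\theta(t)\to\pi$ as $t\to+\infty$. Then for every $z\in\mathbb R\oplus M\mathbb R$ the improper line integral below exists, $\Gamma(z)\neq 0$ unless $z\in\{0,-1,-2,\dots\}$, and $$\frac1{\Gamma(z)}=\frac1{2\pi}\left(\int_\psi e^{\zeta}\zeta^{-z}\,d\zeta\right)M^*,$$ where $\zeta^{-z}=\exp(-z\,\mathrm{Ln}\,\zeta)$ and, at $\zeta=\psi(t)$, $\mathrm{Ln}\,\zeta=\ln|\zeta|+\theta(t)M$ (the principal value of $\mathrm{Ln}$ if $\psi$ does not meet $(-\infty,0]$). -/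

import Mathlib

open MeasureTheory Filter Topology

/-- The underlying space of the Cayley–Dickson algebra `𝒜_v` over `ℝ`: `𝒜_0 = ℝ`, and `𝒜_{v+1}`
consists of pairs from `𝒜_v`, with the Euclidean norm. -/
def CayleyDickson : ℕ → Type
  | 0 => ℝ
  | v + 1 => WithLp 2 (CayleyDickson v × CayleyDickson v)

namespace CayleyDickson

noncomputable section

/-- The Euclidean norm on `𝒜_v ≅ ℝ^(2^v)`. -/
instance instNormedAddCommGroup : (v : ℕ) → NormedAddCommGroup (CayleyDickson v)
  | 0 => inferInstanceAs (NormedAddCommGroup ℝ)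
  | v + 1 =>
    letI := instNormedAddCommGroup v
    inferInstanceAs (NormedAddCommGroup (WithLp 2 (CayleyDickson v × CayleyDickson v)))

instance instNormedSpace : (v : ℕ) → NormedSpace ℝ (CayleyDickson v)
  | 0 => inferInstanceAs (NormedSpace ℝ ℝ)
  | v + 1 =>
    letI := instNormedSpace v
    inferInstanceAs (NormedSpace ℝ (WithLp 2 (CayleyDickson v × CayleyDickson v)))

instance instCompleteSpace : (v : ℕ) → CompleteSpace (CayleyDickson v)
  | 0 => inferInstanceAs (CompleteSpace ℝ)
  | v + 1 =>
    letI := instCompleteSpace v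
    inferInstanceAs (CompleteSpace (WithLp 2 (CayleyDickson v × CayleyDickson v)))

/-- Conjugation: trivial on `ℝ`, and `(a, b)* = (a*, -b)` on pairs. -/
def conj : (v : ℕ) → CayleyDickson v → CayleyDickson v
  | 0, x => x
  | v + 1, x => WithLp.toLp 2 (conj v (WithLp.ofLp x).1, -(WithLp.ofLp x).2)

/-- The doubling procedure: `(a, b) (c, d) = (a c - d* b, d a + b c*)`. -/
def mul : (v : ℕ) → CayleyDickson v → CayleyDickson v → CayleyDickson v
  | 0, x, y => ((show ℝ from x) * (show ℝ from y) : ℝ)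
  | v + 1, x, y =>
    let a := (WithLp.ofLp x).1
    let b := (WithLp.ofLp x).2
    let c := (WithLp.ofLp y).1
    let d := (WithLp.ofLp y).2
    WithLp.toLp 2 (mul v a c - mul v (conj v d) b, mul v d a + mul v b (conj v c))

/-- The unit element. -/
def one : (v : ℕ) → CayleyDickson v
  | 0 => (1 : ℝ)
  | v + 1 => WithLp.toLp 2 (one v, 0)

instance (v : ℕ) : Star (CayleyDickson v) := ⟨conj v⟩
instance (v : ℕ) : Mul (CayleyDickson v) := ⟨mul v⟩
instance (v : ℕ) : One (CayleyDickson v) := ⟨one v⟩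

/-- The real part, as a real number. -/
def re : (v : ℕ) → CayleyDickson v → ℝ
  | 0, x => x
  | v + 1, x => re v (WithLp.ofLp x).1

/-- The real part is `(z + z*) / 2`. -/
theorem half_smul_add_star {v : ℕ} (z : CayleyDickson v) :
    (1 / 2 : ℝ) • (z + star z) = re v z • (1 : CayleyDickson v) := by
  induction v with
  | zero =>
    change (1 / 2 : ℝ) * ((show ℝ from z) + (show ℝ from z)) = (show ℝ from z) * 1
    ring
  | succ v ih =>
    apply (WithLp.equiv 2 (CayleyDickson v × CayleyDickson v)).injective
    refine Prod.ext (ih (WithLp.ofLp z).1) ?_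
    change (1 / 2 : ℝ) • ((WithLp.ofLp z).2 + -(WithLp.ofLp z).2) =
      re v (WithLp.ofLp z).1 • (0 : CayleyDickson v)
    simp

variable {v : ℕ}

/-- The inverse `x⁻¹ = x* / |x|²` (for `x ≠ 0`). -/
instance : Inv (CayleyDickson v) := ⟨fun x => (‖x‖ ^ 2)⁻¹ • star x⟩

/-- Powers `x^n`, with `x^0 = 1` and `x^(n+1) = x^n x`. -/
def pow (x : CayleyDickson v) : ℕ → CayleyDickson v
  | 0 => 1
  | n + 1 => pow x n * x

/-- The exponential function `exp x = ∑ xⁿ / n!`. -/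
def exp (x : CayleyDickson v) : CayleyDickson v :=
  ∑' n : ℕ, ((n.factorial : ℝ)⁻¹) • pow x n

/-- `M` is a purely imaginary Cayley–Dickson number with `|M| = 1`. -/
def IsImaginaryUnit (M : CayleyDickson v) : Prop := re v M = 0 ∧ ‖M‖ = 1

/-- The map `x + i y ↦ x + y M` of `ℂ` onto the plane `ℝ ⊕ Mℝ`. -/
def ofPlane (M : CayleyDickson v) (w : ℂ) : CayleyDickson v :=
  w.re • (1 : CayleyDickson v) + w.im • M

/-- The plane `ℝ ⊕ Mℝ`. -/
def plane (M : CayleyDickson v) : Set (CayleyDickson v) := Set.range (ofPlane M)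

/-- The points `0, -1, -2, …` of `𝒜_v`. -/
def IsNonposInt (z : CayleyDickson v) : Prop := ∃ n : ℕ, z = (-(n : ℝ)) • (1 : CayleyDickson v)

/-- The Eulerian integral `∫_0^∞ e^{-t} t^{z-1} dt`, where `t^{z-1} = exp ((z - 1) ln t)`. -/
def eulerIntegral (z : CayleyDickson v) : CayleyDickson v :=
  ∫ t in Set.Ioi (0 : ℝ), Real.exp (-t) • exp (Real.log t • (z - 1))

/-- `G` is the Gamma function on `𝒜_v ∖ {0, -1, -2, …}`: it is the Eulerian integral where that
integral converges, continued holomorphically in each of the complex planes `ℝ ⊕ Mℝ`. (These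
planes cover `𝒜_v` for `v ≥ 1`, so that `G` is determined off `{0, -1, -2, …}`.) -/
def IsGammaFunction (G : CayleyDickson v → CayleyDickson v) : Prop :=
  (∀ z : CayleyDickson v, 0 < re v z → G z = eulerIntegral z) ∧
  ∀ M : CayleyDickson v, IsImaginaryUnit M →
    ∃ g : ℂ → ℂ, DifferentiableOn ℂ g {w : ℂ | ∀ n : ℕ, w ≠ -(n : ℂ)} ∧
      ∀ w : ℂ, (∀ n : ℕ, w ≠ -(n : ℂ)) → G (ofPlane M w) = ofPlane M (g w)

/-- The Gamma function on `𝒜_v`; its values at the poles `0, -1, -2, …` mean nothing. -/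
def Gamma : CayleyDickson v → CayleyDickson v :=
  Classical.epsilon IsGammaFunction

open Classical in
/-- The function `1 / Γ`, with the value `0` at the poles `0, -1, -2, …` of `Γ`. -/
def recipGamma (z : CayleyDickson v) : CayleyDickson v :=
  if IsNonposInt z then 0 else (Gamma z)⁻¹

/-- `ψ` is a Hankel loop in the plane `ℝ ⊕ Mℝ` and `θ` is the continuous argument along it: `ψ` is
a continuous, locally rectifiable curve in the plane without `0` that comes from `-∞` along the
negative real axis with argument `-π` (lower edge of the cut), runs once around `0` in the positive
direction, and goes back to `-∞` with argument `π` (upper edge of the cut). If `ψ` does not meet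
`(-∞, 0]`, then `θ` is the principal argument; pieces of `ψ` that lie on `(-∞, 0]` are on the edge
of the cut that `θ` tells. -/
structure IsHankelLoop (M : CayleyDickson v) (ψ : ℝ → CayleyDickson v) (θ : ℝ → ℝ) : Prop where
  continuous : Continuous ψ
  rectifiable : LocallyBoundedVariationOn ψ Set.univ
  ne_zero : ∀ t, ψ t ≠ 0
  continuous_arg : Continuous θ
  polar : ∀ t, ψ t = ‖ψ t‖ • ofPlane M (Complex.exp (θ t * Complex.I))
  norm_start : Tendsto (fun t => ‖ψ t‖) atBot atTop
  norm_end : Tendsto (fun t => ‖ψ t‖) atTop atTop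
  arg_start : Tendsto θ atBot (𝓝 (-Real.pi))
  arg_end : Tendsto θ atTop (𝓝 Real.pi)

/-- The logarithm `ln |ζ| + θ M` of the point `ζ = |ζ| e^{θ M}` with the argument `θ`. -/
def logArg (M ζ : CayleyDickson v) (θ : ℝ) : CayleyDickson v :=
  Real.log ‖ζ‖ • (1 : CayleyDickson v) + θ • M

/-- `I` is the line integral `∫ f(ζ) dζ` along the curve `ζ = ψ t`, `a ≤ t ≤ b`, the integrand
being given as a function `f` of the parameter: the sums `∑ f(τ_k) (ψ(t_{k+1}) - ψ(t_k))` tend to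
`I` as the mesh of the partition `a = t_0 ≤ ⋯ ≤ t_n = b` with tags `τ_k ∈ [t_k, t_{k+1}]` tends
to `0`. -/
def HasLineIntegral (f ψ : ℝ → CayleyDickson v) (a b : ℝ) (I : CayleyDickson v) : Prop :=
  ∀ ε > 0, ∃ δ > 0, ∀ (n : ℕ) (t τ : ℕ → ℝ), t 0 = a → t n = b →
    (∀ k < n, t k ≤ τ k ∧ τ k ≤ t (k + 1) ∧ t (k + 1) - t k < δ) →
    ‖(∑ k ∈ Finset.range n, f (τ k) * (ψ (t (k + 1)) - ψ (t k))) - I‖ < ε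

/-- `I` is the improper line integral of `f` along the whole curve `ψ`: the integrals over compact
parameter intervals `[a, b]` exist and tend to `I` as `a → -∞` and `b → ∞` independently. -/
def HasImproperLineIntegral (f ψ : ℝ → CayleyDickson v) (I : CayleyDickson v) : Prop :=
  ∃ J : ℝ → ℝ → CayleyDickson v, (∀ a b, a ≤ b → HasLineIntegral f ψ a b (J a b)) ∧
    Tendsto (fun p : ℝ × ℝ => J p.1 p.2) (atBot ×ˢ atTop) (𝓝 I)

end

end CayleyDickson

/-! Writing ζ = e^w with w = ln|ζ| + iθ along the loop turns e^ζ ζ^{-z} dζ into exp(e^w + (1 - z)w)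
dw. The coefficient is entire in w, so it has an entire primitive Φ. Hence the integral over a
compact piece of the loop is an increment of Φ between two endpoints
(`exists_forall_norm_sum_sub_lt`). No deformation of contours is needed, and crossings of the
negative axis do no harm, since θ already selects the sheet.

Near Im w = ±π the integrand decays doubly exponentially as Re w → ∞. So Φ has a limit on each of
these edges, shared by all curves asymptotic to the edge (`tendsto_of_tendsto_horizontal`). What
remains is the limit of Φ(x + πi) - Φ(x - πi) (`tendsto_stripIncrement`). For Re z < 1 this vanishes
as x → -∞, and the two edges contribute Γ(1 - z) with different phases; the reflection formula gives
2πi/Γ(z). Integration by parts carries the result from z - 1 to z, except at z = 1, which is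
computed directly.

Each plane ℝ ⊕ Mℝ is an isometric copy of ℂ compatible with product, conjugation and exponential, so
the lack of associativity plays no role. On it Γ is the complex Gamma function, by the identity
theorem (`IsGammaFunction.ofPlane_eq`). -/

namespace HankelContour

/-- The integrand `e^ζ ζ^{-z} dζ` of Hankel's integral after the substitution `ζ = e^w`. -/
noncomputable def integrand (z w : ℂ) : ℂ := Complex.exp (Complex.exp w + (1 - z) * w)

theorem differentiable_integrand (z : ℂ) : Differentiable ℂ (integrand z) := by
  unfold integrand; fun_prop

theorem integrand_eq_mul_exp (z w : ℂ) :
    integrand z w = Complex.exp (Complex.exp w) * Complex.exp (-(z * w)) * Complex.exp w := by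
  rw [integrand, ← Complex.exp_add, ← Complex.exp_add]
  ring_nf

theorem exists_primitive (z : ℂ) : ∃ Φ : ℂ → ℂ, ∀ w, HasDerivAt Φ (integrand z w) w := by
  obtain ⟨Φ, h⟩ := (differentiable_integrand z).isExactOn_univ
  exact ⟨Φ, fun w => h w trivial⟩

theorem norm_integrand (z w : ℂ) : ‖integrand z w‖ =
    Real.exp (Real.exp w.re * Real.cos w.im + ((1 - z.re) * w.re + z.im * w.im)) := by
  rw [integrand, Complex.norm_exp]
  simp [Complex.exp_re]

/-! ### Line integrals through primitives -/

/-- For small u, e^u - 1 differs from u by at most |u|². This lets errors in w be charged to the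
variation of e^w, the curve whose rectifiability is given. -/
theorem norm_sub_le_two_mul_norm_exp_sub {w₁ w₂ : ℂ} (h : ‖w₂ - w₁‖ ≤ 1 / 2) :
    ‖Complex.exp w₁‖ * ‖w₂ - w₁‖ ≤ 2 * ‖Complex.exp w₂ - Complex.exp w₁‖ := by
  set u := w₂ - w₁ with hu
  have e : Complex.exp w₂ - Complex.exp w₁ = Complex.exp w₁ * (Complex.exp u - 1) := by
    rw [mul_sub, ← Complex.exp_add, hu]; ring_nf
  have h1 := Complex.norm_exp_sub_one_sub_id_le (x := u) (by linarith)
  have h2 : ‖u‖ ≤ 2 * ‖Complex.exp u - 1‖ := by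
    have h3 : ‖u‖ - ‖Complex.exp u - 1‖ ≤ ‖Complex.exp u - 1 - u‖ := by
      rw [← norm_neg (Complex.exp u - 1 - u), neg_sub]
      exact norm_sub_norm_le _ _
    nlinarith [norm_nonneg u]
  rw [e, norm_mul]
  nlinarith [norm_nonneg (Complex.exp w₁)]

/-- A primitive of `f(w) e^w dw` is approximated by `f · (e^w)` uniformly near a compact set. -/
theorem exists_forall_norm_primitive_sub_le {f Φ : ℂ → ℂ} (hf : Continuous f)
    (hΦ : ∀ w, HasDerivAt Φ (f w * Complex.exp w) w) {K : Set ℂ} (hK : IsCompact K)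
    {ε : ℝ} (hε : 0 < ε) :
    ∃ r > 0, ∀ w₀ ∈ K, ∀ w₁ ∈ Metric.ball w₀ r, ∀ w₂ ∈ Metric.ball w₀ r,
      ‖f w₀ * (Complex.exp w₂ - Complex.exp w₁) - (Φ w₂ - Φ w₁)‖ ≤
        ε * ‖Complex.exp w₂ - Complex.exp w₁‖ := by
  -- One factor 2 is lost in bounding |e^{w - w₁}|, another in passing from w₂ - w₁ to e^{w₂} -
  -- e^{w₁}; hence ε / 4. The cap 1/4 on the radius keeps points of the ball within 1/2 of each
  -- other.
  have hu := hK.uniformContinuousAt_of_continuousAt f (fun _ _ => hf.continuousAt)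
    (Metric.dist_mem_uniformity (show 0 < ε / 4 by positivity))
  obtain ⟨r, hr, H⟩ := Metric.mem_uniformity_dist.1 hu
  refine ⟨min r (1 / 4), by positivity, fun w₀ hw₀ w₁ hw₁ w₂ hw₂ => ?_⟩
  have hball : ∀ w ∈ Metric.ball w₀ (min r (1 / 4)), ‖w - w₁‖ ≤ 1 / 2 := fun w hw => by
    rw [← dist_eq_norm]
    have h1 := (Metric.mem_ball.1 hw).trans_le (min_le_right _ _)
    have h2 := (Metric.mem_ball.1 hw₁).trans_le (min_le_right _ _)
    linarith [dist_triangle_right w w₁ w₀]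
  -- The function f(w₀) e^w - Φ(w) has the small derivative (f(w₀) - f(w)) e^w, so the mean value
  -- inequality applies on the ball.
  have hd : ∀ w ∈ Metric.ball w₀ (min r (1 / 4)),
      HasDerivWithinAt (fun w => f w₀ * Complex.exp w - Φ w)
        (f w₀ * Complex.exp w - f w * Complex.exp w) (Metric.ball w₀ (min r (1 / 4))) w :=
    fun w _ => (((Complex.hasDerivAt_exp w).const_mul _).sub (hΦ w)).hasDerivWithinAt
  have hb : ∀ w ∈ Metric.ball w₀ (min r (1 / 4)),
      ‖f w₀ * Complex.exp w - f w * Complex.exp w‖ ≤ ε / 4 * (2 * ‖Complex.exp w₁‖) := fun w hw => by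
    rw [← sub_mul, norm_mul]
    have h1 : dist (f w₀) (f w) < ε / 4 := by
      refine H ?_ hw₀
      rw [dist_comm]
      exact (Metric.mem_ball.1 hw).trans_le (min_le_left _ _)
    rw [dist_eq_norm] at h1
    refine mul_le_mul h1.le ?_ (norm_nonneg _) (by positivity)
    have h2 : Complex.exp w = Complex.exp (w - w₁) * Complex.exp w₁ := by
      rw [← Complex.exp_add]; ring_nf
    rw [h2, norm_mul]
    refine mul_le_mul_of_nonneg_right ?_ (norm_nonneg _)
    have h3 := Complex.norm_exp_sub_one_le (x := w - w₁) (by linarith [hball w hw])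
    have h4 : ‖Complex.exp (w - w₁)‖ ≤ ‖Complex.exp (w - w₁) - 1‖ + ‖(1 : ℂ)‖ := by
      simpa using norm_add_le (Complex.exp (w - w₁) - 1) 1
    rw [norm_one] at h4
    linarith [hball w hw]
  have key := (convex_ball w₀ _).norm_image_sub_le_of_norm_hasDerivWithin_le hd hb hw₁ hw₂
  have hl := norm_sub_le_two_mul_norm_exp_sub (hball w₂ hw₂)
  calc ‖f w₀ * (Complex.exp w₂ - Complex.exp w₁) - (Φ w₂ - Φ w₁)‖
      = ‖(f w₀ * Complex.exp w₂ - Φ w₂) - (f w₀ * Complex.exp w₁ - Φ w₁)‖ := by ring_nf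
    _ ≤ _ := key
    _ ≤ _ := by nlinarith

/-- The Riemann–Stieltjes sums of `∫ f(w t) d(e^{w t})` tend to the increment of a primitive of
`f(w) e^w`, for a continuous `w` such that `e^w` is locally rectifiable. -/
theorem exists_forall_norm_sum_sub_lt {f Φ : ℂ → ℂ} (hf : Continuous f)
    (hΦ : ∀ w, HasDerivAt Φ (f w * Complex.exp w) w) {w : ℝ → ℂ} (hw : Continuous w)
    (hv : LocallyBoundedVariationOn (fun t => Complex.exp (w t)) Set.univ) (a b : ℝ)
    {ε : ℝ} (hε : 0 < ε) :
    ∃ δ > 0, ∀ (n : ℕ) (t τ : ℕ → ℝ), t 0 = a → t n = b →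
      (∀ k < n, t k ≤ τ k ∧ τ k ≤ t (k + 1) ∧ t (k + 1) - t k < δ) →
      ‖(∑ k ∈ Finset.range n,
          f (w (τ k)) * (Complex.exp (w (t (k + 1))) - Complex.exp (w (t k)))) -
        (Φ (w b) - Φ (w a))‖ < ε := by
  set p : ℝ → ℂ := fun t => Complex.exp (w t) with hp
  have hbv : eVariationOn p (Set.univ ∩ Set.Icc a b) ≠ ⊤ := hv a b trivial trivial
  set V := (eVariationOn p (Set.univ ∩ Set.Icc a b)).toReal with hV
  have hV0 : 0 ≤ V := ENNReal.toReal_nonneg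
  -- Dividing by V + 1 covers V = 0 and makes the final inequality strict.
  obtain ⟨r, hr, H⟩ := exists_forall_norm_primitive_sub_le hf hΦ
    ((isCompact_Icc (a := a) (b := b)).image hw) (show 0 < ε / (V + 1) by positivity)
  have hu := (isCompact_Icc (a := a) (b := b)).uniformContinuousAt_of_continuousAt w
    (fun _ _ => hw.continuousAt) (Metric.dist_mem_uniformity hr)
  obtain ⟨δ, hδ, Hδ⟩ := Metric.mem_uniformity_dist.1 hu
  refine ⟨δ, hδ, fun n t τ h0 hn ht => ?_⟩
  have hmono : MonotoneOn t (Set.Iic n) := by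
    intro i _ j hj hij
    induction j, hij using Nat.le_induction with
    | base => exact le_rfl
    | succ j hij ih =>
      have hj' : j < n := hj
      exact (ih hj'.le).trans ((ht j hj').1.trans (ht j hj').2.1)
  have hmem : ∀ i ≤ n, t i ∈ Set.Icc a b := fun i hi => by
    rw [← h0, ← hn]
    exact ⟨hmono (Nat.zero_le n) hi (Nat.zero_le i), hmono hi (le_refl n) hi⟩
  have hvar : ∑ k ∈ Finset.range n, ‖p (t (k + 1)) - p (t k)‖ ≤ V := by
    have h1 := ENNReal.toReal_mono hbv
      (eVariationOn.sum_le_of_monotoneOn_Iic (f := p) hmono fun i hi => ⟨trivial, hmem i hi⟩)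
    rw [ENNReal.toReal_sum fun _ _ => edist_ne_top _ _] at h1
    simpa only [← dist_edist, dist_eq_norm] using h1
  have hstep : ∀ k ∈ Finset.range n,
      ‖f (w (τ k)) * (p (t (k + 1)) - p (t k)) - (Φ (w (t (k + 1))) - Φ (w (t k)))‖ ≤
        ε / (V + 1) * ‖p (t (k + 1)) - p (t k)‖ := fun k hk => by
    rw [Finset.mem_range] at hk
    obtain ⟨h1, h2, h3⟩ := ht k hk
    have hτ : τ k ∈ Set.Icc a b := ⟨(hmem k hk.le).1.trans h1, h2.trans (hmem (k + 1) hk).2⟩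
    refine H _ (Set.mem_image_of_mem w hτ) _ ?_ _ ?_
    · rw [Metric.mem_ball, dist_comm]
      refine Hδ ?_ hτ
      rw [Real.dist_eq, abs_of_nonneg (by linarith)]
      linarith
    · rw [Metric.mem_ball, dist_comm]
      refine Hδ ?_ hτ
      rw [Real.dist_eq, abs_of_nonpos (by linarith)]
      linarith
  have htel : Φ (w b) - Φ (w a) = ∑ k ∈ Finset.range n, (Φ (w (t (k + 1))) - Φ (w (t k))) := by
    rw [Finset.sum_range_sub (fun k => Φ (w (t k))), h0, hn]
  rw [htel, ← Finset.sum_sub_distrib]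
  calc _ ≤ ∑ k ∈ Finset.range n, ε / (V + 1) * ‖p (t (k + 1)) - p (t k)‖ :=
        norm_sum_le_of_le _ hstep
    _ ≤ ε / (V + 1) * V := by
        rw [← Finset.mul_sum]
        exact mul_le_mul_of_nonneg_left hvar (by positivity)
    _ < ε := by
        rw [div_mul_eq_mul_div, div_lt_iff₀ (by positivity)]
        nlinarith

/-! ### Behaviour of the primitives at the ends of the strip -/

/-- With y = e^x this is the decay of y^c e^{-y/2}. -/
theorem tendsto_exp_neg_exp_div_two (c : ℝ) :
    Tendsto (fun x : ℝ => Real.exp (-Real.exp x / 2 + c * x)) atTop (𝓝 0) := by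
  have h := (tendsto_rpow_mul_exp_neg_mul_atTop_nhds_zero c (1 / 2) (by norm_num)).comp
    Real.tendsto_exp_atTop
  refine h.congr fun x => ?_
  rw [Function.comp_apply, ← Real.exp_mul, ← Real.exp_add]
  ring_nf

theorem cos_le_neg_half {y : ℝ} (hy : |(|y| - Real.pi)| ≤ 1) : Real.cos y ≤ -1 / 2 := by
  have h1 : Real.cos y = -Real.cos (|y| - Real.pi) := by
    rw [Real.cos_sub_pi, Real.cos_abs, neg_neg]
  have h2 := Real.one_sub_sq_div_two_le_cos (x := |y| - Real.pi)
  have h3 : (|y| - Real.pi) ^ 2 ≤ 1 := by rw [← sq_abs]; nlinarith [abs_nonneg (|y| - Real.pi)]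
  linarith

theorem norm_integrand_le (z : ℂ) {w : ℂ} (hw : |(|w.im| - Real.pi)| ≤ 1) :
    ‖integrand z w‖ ≤
      Real.exp (5 * |z.im|) * Real.exp (-Real.exp w.re / 2 + (1 - z.re) * w.re) := by
  rw [norm_integrand, ← Real.exp_add, Real.exp_le_exp]
  have h1 := mul_le_mul_of_nonneg_left (cos_le_neg_half hw) (Real.exp_pos w.re).le
  -- The constant comes from |Im w| ≤ π + 1 < 5.
  have h2 : z.im * w.im ≤ 5 * |z.im| := by
    have h3 : |w.im| ≤ 5 := by linarith [(abs_le.1 hw).2, Real.pi_lt_four]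
    have h4 := le_abs_self (z.im * w.im)
    rw [abs_mul] at h4
    nlinarith [abs_nonneg z.im]
  linarith

theorem tendsto_integrand_zero (z : ℂ) {ι : Type*} {l : Filter ι} {w : ι → ℂ}
    (hre : Tendsto (fun i => (w i).re) l atTop) (him : ∀ᶠ i in l, |(|(w i).im| - Real.pi)| ≤ 1) :
    Tendsto (fun i => integrand z (w i)) l (𝓝 0) := by
  have h := ((tendsto_exp_neg_exp_div_two (1 - z.re)).comp hre).const_mul (Real.exp (5 * |z.im|))
  rw [mul_zero] at h
  refine squeeze_zero_norm' ?_ h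
  filter_upwards [him] with i hi using norm_integrand_le z hi

theorem abs_abs_sub_pi_le {y s : ℝ} (hs : |s| = Real.pi) (hy : |y - s| ≤ 1) :
    |(|y| - Real.pi)| ≤ 1 := by
  rw [← hs]
  exact (abs_abs_sub_abs_le_abs_sub y s).trans hy

theorem ofReal_add_mul_I_re (x s : ℝ) : ((x : ℂ) + s * Complex.I).re = x := by simp

theorem ofReal_add_mul_I_im (x s : ℝ) : ((x : ℂ) + s * Complex.I).im = s := by simp

theorem hasDerivAt_horizontal {z : ℂ} {Φ : ℂ → ℂ} (hΦ : ∀ w, HasDerivAt Φ (integrand z w) w)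
    (s x : ℝ) : HasDerivAt (fun x : ℝ => Φ (x + s * Complex.I))
      (integrand z (x + s * Complex.I)) x := by
  have h1 : HasDerivAt (fun y : ℂ => Φ (y + s * Complex.I)) (integrand z (x + s * Complex.I)) x :=
    HasDerivAt.comp_add_const (x : ℂ) _ (hΦ _)
  exact h1.comp_ofReal

theorem continuous_integrand_horizontal (z : ℂ) (s : ℝ) :
    Continuous fun x : ℝ => integrand z (x + s * Complex.I) :=
  (differentiable_integrand z).continuous.comp (by fun_prop)

theorem integrableOn_integrand_Ioi (z : ℂ) {s : ℝ} (hs : |s| = Real.pi) :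
    IntegrableOn (fun x : ℝ => integrand z (x + s * Complex.I)) (Set.Ioi 0) := by
  rw [IntegrableOn, ← integrable_norm_iff
    (continuous_integrand_horizontal z s).aestronglyMeasurable.restrict]
  refine integrable_of_isBigO_exp_neg one_pos
    (continuous_integrand_horizontal z s).norm.continuousOn ?_
  rw [Asymptotics.isBigO_norm_left]
  -- Lowering z by 1 multiplies the integrand by e^w, of modulus e^x on the edge. Convergence to 0
  -- for z - 1 therefore says that the integrand for z is o(e^{-x}).
  have h := tendsto_integrand_zero (z - 1) (l := atTop) (w := fun x : ℝ => (x : ℂ) + s * Complex.I)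
    (by simp only [ofReal_add_mul_I_re]; exact tendsto_id) (Eventually.of_forall fun x => by simp [hs])
  refine Asymptotics.IsLittleO.isBigO ?_
  refine (Asymptotics.isLittleO_iff).2 fun c hc => ?_
  filter_upwards [(Metric.tendsto_nhds.1 h) c hc] with x hx
  rw [dist_zero_right] at hx
  have e : integrand (z - 1) (x + s * Complex.I) =
      integrand z (x + s * Complex.I) * Complex.exp (x + s * Complex.I) := by
    rw [integrand, integrand, ← Complex.exp_add]; ring_nf
  rw [e, norm_mul, Complex.norm_exp, ofReal_add_mul_I_re] at hx
  rw [Real.norm_eq_abs, Real.abs_exp, neg_one_mul, Real.exp_neg, ← div_eq_mul_inv,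
    le_div_iff₀ (Real.exp_pos x)]
  exact hx.le

theorem exists_tendsto_horizontal {z : ℂ} {Φ : ℂ → ℂ}
    (hΦ : ∀ w, HasDerivAt Φ (integrand z w) w) {s : ℝ} (hs : |s| = Real.pi) :
    ∃ L, Tendsto (fun x : ℝ => Φ (x + s * Complex.I)) atTop (𝓝 L) :=
  ⟨_, tendsto_limUnder_of_hasDerivAt_of_integrableOn_Ioi
    (fun x _ => hasDerivAt_horizontal hΦ s x) (integrableOn_integrand_Ioi z hs)⟩

/-- The limit along the edge of the strip is also the limit along curves asymptotic to it. -/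
theorem tendsto_of_tendsto_horizontal {z : ℂ} {Φ : ℂ → ℂ}
    (hΦ : ∀ w, HasDerivAt Φ (integrand z w) w) {s : ℝ} (hs : |s| = Real.pi) {L : ℂ}
    (hL : Tendsto (fun x : ℝ => Φ (x + s * Complex.I)) atTop (𝓝 L))
    {ι : Type*} {l : Filter ι} {w : ι → ℂ}
    (hre : Tendsto (fun i => (w i).re) l atTop) (him : Tendsto (fun i => (w i).im) l (𝓝 s)) :
    Tendsto (fun i => Φ (w i)) l (𝓝 L) := by
  have h := ((tendsto_exp_neg_exp_div_two (1 - z.re)).comp hre).const_mul (Real.exp (5 * |z.im|))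
  rw [mul_zero] at h
  -- Compare with the edge along a vertical segment of length at most 1, on which the decay bound
  -- depends on the abscissa only.
  have hd : Tendsto (fun i => Φ (w i) - Φ ((w i).re + s * Complex.I)) l (𝓝 0) := by
    refine squeeze_zero_norm' ?_ h
    filter_upwards [Metric.tendsto_nhds.1 him 1 one_pos] with i hi
    rw [Real.dist_eq] at hi
    have hw : w i ∈ segment ℝ ((w i).re + s * Complex.I) (w i) := right_mem_segment ℝ _ _
    have hb : ∀ u ∈ segment ℝ ((w i).re + s * Complex.I) (w i), ‖integrand z u‖ ≤
        Real.exp (5 * |z.im|) *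
          Real.exp (-Real.exp (w i).re / 2 + (1 - z.re) * (w i).re) := by
      rintro u ⟨a, b, ha, hb, hab, rfl⟩
      have e1 : (a • ((w i).re + s * Complex.I) + b • w i : ℂ).re = (w i).re := by
        simp; linear_combination (w i).re * hab
      have e2 : (a • ((w i).re + s * Complex.I) + b • w i : ℂ).im - s = b * ((w i).im - s) := by
        simp; linear_combination s * hab
      have := norm_integrand_le z (w := a • ((w i).re + s * Complex.I) + b • w i)
        (abs_abs_sub_pi_le hs (by
          rw [e2, abs_mul, abs_of_nonneg hb]; nlinarith [abs_nonneg ((w i).im - s)]))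
      rwa [e1] at this
    have key := (convex_segment _ _).norm_image_sub_le_of_norm_hasDerivWithin_le
      (fun u _ => (hΦ u).hasDerivWithinAt) hb (left_mem_segment ℝ _ _) hw
    refine key.trans (mul_le_of_le_one_right (by positivity) ?_)
    have e : w i - ((w i).re + s * Complex.I) = ((w i).im - s : ℝ) * Complex.I := by
      apply Complex.ext <;> simp
    rw [e, norm_mul, Complex.norm_I, mul_one, Complex.norm_real]
    exact hi.le
  simpa using hd.add (hL.comp hre)

/-! ### Increments across the strip and the value 2πi/Γ(z) -/

/-- The increment of `Φ` across the strip `|Im w| ≤ π` at the abscissa `x`. -/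
noncomputable def stripIncrement (Φ : ℂ → ℂ) (x : ℝ) : ℂ :=
  Φ (x + (Real.pi : ℝ) * Complex.I) - Φ (x + (-Real.pi : ℝ) * Complex.I)

/-- On both edges e^w = -e^x, so up to a constant phase the integrand is Euler's integrand for Γ(1 -
z) after t = e^x, Jacobian included. -/
theorem integrand_horizontal (z : ℂ) {s : ℝ} (hs : |s| = Real.pi) (x : ℝ) :
    integrand z (x + s * Complex.I) = Complex.exp ((1 - z) * (s * Complex.I)) *
      (Real.exp x • ((Real.exp (-Real.exp x) : ℂ) * (Real.exp x : ℂ) ^ ((1 - z) - 1))) := by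
  have h1 : Complex.exp (s * Complex.I) = -1 := by
    rcases eq_or_eq_neg_of_abs_eq hs with rfl | rfl
    · exact Complex.exp_pi_mul_I
    · rw [Complex.ofReal_neg, neg_mul, Complex.exp_neg, Complex.exp_pi_mul_I]; norm_num
  have h2 : (Real.exp x : ℂ) ≠ 0 := by exact_mod_cast (Real.exp_pos x).ne'
  rw [integrand, Complex.exp_add (x : ℂ), h1, Complex.real_smul, Complex.cpow_def_of_ne_zero h2,
    ← Complex.ofReal_log (Real.exp_pos x).le, Real.log_exp]
  push_cast
  simp only [← Complex.exp_add]
  ring_nf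

theorem integrable_integrand_horizontal {z : ℂ} (hz : z.re < 1) {s : ℝ} (hs : |s| = Real.pi) :
    Integrable (fun x : ℝ => integrand z (x + s * Complex.I)) := by
  simp only [integrand_horizontal z hs]
  refine Integrable.const_mul ?_ _
  have h := (integrableOn_image_iff_integrableOn_abs_deriv_smul MeasurableSet.univ
    (fun x _ => (Real.hasDerivAt_exp x).hasDerivWithinAt) Real.exp_injective.injOn
    (fun t : ℝ => (Real.exp (-t) : ℂ) * (t : ℂ) ^ ((1 - z) - 1))).1
    (by rw [Set.image_univ, Real.range_exp]
        exact Complex.GammaIntegral_convergent (by simpa using hz))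
  simpa only [Real.abs_exp, integrableOn_univ] using h

theorem integral_integrand_horizontal {z : ℂ} (hz : z.re < 1) {s : ℝ} (hs : |s| = Real.pi) :
    ∫ x : ℝ, integrand z (x + s * Complex.I) =
      Complex.exp ((1 - z) * (s * Complex.I)) * Complex.Gamma (1 - z) := by
  simp only [integrand_horizontal z hs]
  rw [integral_const_mul, Complex.Gamma_eq_integral (by simpa using hz), Complex.GammaIntegral]
  have h := integral_image_eq_integral_abs_deriv_smul MeasurableSet.univ
    (fun x _ => (Real.hasDerivAt_exp x).hasDerivWithinAt) Real.exp_injective.injOn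
    (fun t : ℝ => (Real.exp (-t) : ℂ) * (t : ℂ) ^ ((1 - z) - 1))
  rw [Set.image_univ, Real.range_exp] at h
  rw [h]
  simp only [Real.abs_exp, Measure.restrict_univ]

/-- Mean value inequality for Φ(w) - cw on a vertical segment of length 2π. It is used as x → -∞,
with c = 0 for Re z < 1 and c = 1 for z = 1. -/
theorem norm_stripIncrement_sub_le {z : ℂ} {Φ : ℂ → ℂ} (hΦ : ∀ w, HasDerivAt Φ (integrand z w) w)
    (c : ℂ) (x : ℝ) {C : ℝ} (hC : ∀ w : ℂ, w.re = x → |w.im| ≤ Real.pi → ‖integrand z w - c‖ ≤ C) :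
    ‖stripIncrement Φ x - c * (2 * Real.pi * Complex.I)‖ ≤ C * (2 * Real.pi) := by
  have hd : ∀ t ∈ Set.Icc (-Real.pi) Real.pi, HasDerivWithinAt
      (fun t : ℝ => Φ (x + t * Complex.I) - c * (x + t * Complex.I))
      ((integrand z (x + t * Complex.I) - c) * Complex.I) (Set.Icc (-Real.pi) Real.pi) t := by
    intro t _
    have h1 : HasDerivAt (fun y : ℂ => x + y * Complex.I) Complex.I (t : ℂ) := by
      simpa using ((hasDerivAt_id (t : ℂ)).mul_const Complex.I).const_add (x : ℂ)
    have h2 : HasDerivAt (fun w => Φ w - c * w) (integrand z (x + t * Complex.I) - c)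
        (x + t * Complex.I) := by
      exact ((hΦ _).sub ((hasDerivAt_id _).const_mul c)).congr_deriv (by rw [mul_one])
    exact (h2.comp (t : ℂ) h1).comp_ofReal.hasDerivWithinAt
  have key := (convex_Icc (-Real.pi) Real.pi).norm_image_sub_le_of_norm_hasDerivWithin_le hd
    (fun t ht => by
      rw [norm_mul, Complex.norm_I, mul_one]
      exact hC _ (ofReal_add_mul_I_re x t) (by rw [ofReal_add_mul_I_im]; exact abs_le.2 ht))
    (Set.left_mem_Icc.2 (by linarith [Real.pi_pos]))
    (Set.right_mem_Icc.2 (by linarith [Real.pi_pos]))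
  have e : ‖Real.pi - -Real.pi‖ = 2 * Real.pi := by
    rw [sub_neg_eq_add, Real.norm_of_nonneg (by linarith [Real.pi_pos])]; ring
  rw [e] at key
  refine le_of_eq_of_le ?_ key
  rw [stripIncrement]
  congr 1
  push_cast
  ring

/-- In the variable ζ this is the vanishing contribution of a small circle around 0; the factor
e^{(1 - Re z)x} needs Re z < 1 to decay. -/
theorem tendsto_stripIncrement_atBot {z : ℂ} (hz : z.re < 1) {Φ : ℂ → ℂ}
    (hΦ : ∀ w, HasDerivAt Φ (integrand z w) w) : Tendsto (stripIncrement Φ) atBot (𝓝 0) := by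
  have hb : Tendsto (fun x : ℝ => Real.exp (Real.exp x + ((1 - z.re) * x + |z.im| * Real.pi)) *
      (2 * Real.pi)) atBot (𝓝 0) := by
    have h1 : Tendsto (fun x : ℝ => Real.exp x + ((1 - z.re) * x + |z.im| * Real.pi))
        atBot atBot :=
      Real.tendsto_exp_atBot.add_atBot (tendsto_atBot_add_const_right _ _
        (tendsto_id.const_mul_atBot (by linarith)))
    simpa using (Real.tendsto_exp_atBot.comp h1).mul_const (2 * Real.pi)
  refine squeeze_zero_norm (fun x => ?_) hb
  have := norm_stripIncrement_sub_le hΦ 0 x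
    (C := Real.exp (Real.exp x + ((1 - z.re) * x + |z.im| * Real.pi))) fun w hw hi => by
      rw [sub_zero, norm_integrand, hw, Real.exp_le_exp]
      have h1 := mul_le_of_le_one_right (Real.exp_pos x).le (Real.cos_le_one w.im)
      have h2 := le_abs_self (z.im * w.im)
      rw [abs_mul] at h2
      have h3 := mul_le_mul_of_nonneg_left hi (abs_nonneg z.im)
      linarith
  simpa using this

theorem stripIncrement_sub {z : ℂ} {Φ : ℂ → ℂ} (hΦ : ∀ w, HasDerivAt Φ (integrand z w) w)
    (a b : ℝ) : stripIncrement Φ b - stripIncrement Φ a =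
      (∫ x in a..b, integrand z (x + (Real.pi : ℝ) * Complex.I)) -
        ∫ x in a..b, integrand z (x + (-Real.pi : ℝ) * Complex.I) := by
  have h : ∀ s : ℝ, ∫ x in a..b, integrand z (x + s * Complex.I) =
      Φ (b + s * Complex.I) - Φ (a + s * Complex.I) := fun s =>
    intervalIntegral.integral_eq_sub_of_hasDerivAt (fun x _ => hasDerivAt_horizontal hΦ s x)
      ((continuous_integrand_horizontal z s).intervalIntegrable a b)
  rw [h, h, stripIncrement, stripIncrement]
  ring

theorem abs_pi : |Real.pi| = Real.pi := abs_of_pos Real.pi_pos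

theorem abs_neg_pi : |-Real.pi| = Real.pi := by rw [abs_neg, abs_pi]

theorem tendsto_stripIncrement_of_re_lt_one {z : ℂ} (hz : z.re < 1) {Φ : ℂ → ℂ}
    (hΦ : ∀ w, HasDerivAt Φ (integrand z w) w) :
    Tendsto (stripIncrement Φ) atTop (𝓝 (2 * Real.pi * Complex.I * (Complex.Gamma z)⁻¹)) := by
  have hi : ∀ s : ℝ, |s| = Real.pi → Tendsto
      (fun x : ℝ => ∫ t in (-x)..x, integrand z (t + s * Complex.I)) atTop
      (𝓝 (Complex.exp ((1 - z) * (s * Complex.I)) * Complex.Gamma (1 - z))) := fun s hs => by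
    rw [← integral_integrand_horizontal hz hs]
    exact intervalIntegral_tendsto_integral (integrable_integrand_horizontal hz hs)
      tendsto_neg_atTop_atBot tendsto_id
  have h := ((hi _ abs_pi).sub (hi _ abs_neg_pi)).add
    ((tendsto_stripIncrement_atBot hz hΦ).comp tendsto_neg_atTop_atBot)
  simp only [← stripIncrement_sub hΦ, Function.comp_apply, sub_add_cancel, add_zero] at h
  convert h using 2
  rw [← sub_mul]
  have hG : Complex.Gamma (1 - z) ≠ 0 := Complex.Gamma_ne_zero_of_re_pos (by simpa using hz)
  have hpi : (Real.pi : ℂ) ≠ 0 := by exact_mod_cast Real.pi_ne_zero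
  have hr := Complex.Gamma_mul_Gamma_one_sub z
  have hsin : Complex.sin (Real.pi * z) * Complex.Gamma (1 - z) =
      Real.pi * (Complex.Gamma z)⁻¹ := by
    -- Since x / 0 = 0, the reflection formula is also stated at its poles. Where Γ(z) takes the
    -- value 0 it forces sin πz = 0, and both sides vanish; elsewhere sin πz ≠ 0 and division is
    -- legitimate.
    rcases eq_or_ne (Complex.Gamma z) 0 with h0 | h0
    · rw [h0, zero_mul, eq_comm, div_eq_zero_iff] at hr
      rw [h0, hr.resolve_left hpi]; simp
    · have hs : Complex.sin (Real.pi * z) ≠ 0 := fun hs => by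
        rw [hs, div_zero] at hr
        exact mul_ne_zero h0 hG hr
      rw [eq_div_iff hs] at hr
      rw [← div_eq_mul_inv, eq_div_iff h0]
      linear_combination hr
  have hexp : Complex.exp ((1 - z) * ((Real.pi : ℝ) * Complex.I)) -
      Complex.exp ((1 - z) * ((-Real.pi : ℝ) * Complex.I)) =
        2 * Complex.I * Complex.sin (Real.pi * z) := by
    have e1 : (1 - z) * ((Real.pi : ℝ) * Complex.I) =
      Real.pi * Complex.I + -(Real.pi * z) * Complex.I := by ring
    have e2 : (1 - z) * ((-Real.pi : ℝ) * Complex.I) =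
      -(Real.pi * Complex.I) + (Real.pi * z) * Complex.I := by push_cast; ring
    rw [e1, e2, Complex.exp_add, Complex.exp_add, Complex.exp_neg, Complex.exp_pi_mul_I,
      Complex.sin]
    linear_combination (Complex.exp (-(Real.pi * z) * Complex.I) -
      Complex.exp (Real.pi * z * Complex.I)) * (-Complex.I_sq)
  rw [hexp]
  linear_combination -2 * Complex.I * hsin

/-- For z = 1 the integrand exp(e^w) has period 2πi, so the increment does not depend on x. As x →
-∞ the integrand tends to 1: this is the residue of e^ζ/ζ at 0. -/
theorem tendsto_stripIncrement_one {Φ : ℂ → ℂ} (hΦ : ∀ w, HasDerivAt Φ (integrand 1 w) w) :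
    Tendsto (stripIncrement Φ) atTop (𝓝 (2 * Real.pi * Complex.I * (Complex.Gamma 1)⁻¹)) := by
  have hper : ∀ x : ℝ, integrand 1 (x + (Real.pi : ℝ) * Complex.I) =
      integrand 1 (x + (-Real.pi : ℝ) * Complex.I) := fun x => by
    simp [integrand, Complex.exp_add, Complex.exp_neg]
  have hconst : ∀ a b, stripIncrement Φ b = stripIncrement Φ a := fun a b => by
    have := stripIncrement_sub hΦ a b
    simp only [hper, sub_self] at this
    exact sub_eq_zero.1 this
  have hlim : Tendsto (stripIncrement Φ) atBot (𝓝 (2 * Real.pi * Complex.I)) := by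
    rw [tendsto_iff_norm_sub_tendsto_zero]
    have hb : Tendsto (fun x : ℝ => 2 * Real.exp x * (2 * Real.pi)) atBot (𝓝 0) := by
      simpa using (Real.tendsto_exp_atBot.const_mul 2).mul_const (2 * Real.pi)
    refine squeeze_zero' (Eventually.of_forall fun _ => norm_nonneg _) ?_ hb
    filter_upwards [eventually_le_atBot (0 : ℝ)] with x hx
    have := norm_stripIncrement_sub_le hΦ 1 x (C := 2 * Real.exp x) fun w hw _ => by
      have hn : ‖Complex.exp w‖ = Real.exp x := by rw [Complex.norm_exp, hw]
      rw [integrand, sub_self, zero_mul, add_zero, ← hn]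
      exact Complex.norm_exp_sub_one_le (by rw [hn]; exact Real.exp_le_one_iff.2 hx)
    simpa using this
  have h0 : stripIncrement Φ 0 = 2 * Real.pi * Complex.I :=
    tendsto_nhds_unique (tendsto_const_nhds.congr fun x => hconst x 0) hlim
  rw [Complex.Gamma_one, inv_one, mul_one, ← h0]
  exact tendsto_const_nhds.congr fun x => hconst x 0

/-- Integration by parts turns primitives for `z` into primitives for `z + 1`. -/
theorem hasDerivAt_integrand_add_one (z w : ℂ) :
    HasDerivAt (integrand (z + 1)) (integrand z w - z * integrand (z + 1) w) w := by
  have h : HasDerivAt (fun w => Complex.exp w + (1 - (z + 1)) * w) (Complex.exp w - z) w := by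
    exact ((Complex.hasDerivAt_exp w).add ((hasDerivAt_id w).const_mul (1 - (z + 1)))).congr_deriv
      (by ring)
  have e : integrand z w = integrand (z + 1) w * Complex.exp w := by
    rw [integrand, integrand, ← Complex.exp_add]; ring_nf
  refine h.cexp.congr_deriv ?_
  rw [e, integrand]
  ring

/-- These are the boundary terms of the integration by parts. -/
theorem tendsto_stripIncrement_integrand (z : ℂ) :
    Tendsto (stripIncrement (integrand z)) atTop (𝓝 0) := by
  have h : ∀ s : ℝ, |s| = Real.pi →
      Tendsto (fun x : ℝ => integrand z (x + s * Complex.I)) atTop (𝓝 0) := fun s hs =>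
    tendsto_integrand_zero z (by simp only [ofReal_add_mul_I_re]; exact tendsto_id)
      (Eventually.of_forall fun x => by simp [hs])
  have := (h _ abs_pi).sub (h _ abs_neg_pi)
  rwa [sub_zero] at this

theorem tendsto_stripIncrement_of_re_lt (n : ℕ) : ∀ {z : ℂ}, z.re < n + 1 → ∀ {Φ : ℂ → ℂ},
    (∀ w, HasDerivAt Φ (integrand z w) w) →
    Tendsto (stripIncrement Φ) atTop (𝓝 (2 * Real.pi * Complex.I * (Complex.Gamma z)⁻¹)) := by
  induction n with
  | zero => exact fun hz _ hΦ => tendsto_stripIncrement_of_re_lt_one (by simpa using hz) hΦ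
  | succ n ih =>
    intro z hz Φ hΦ
    rcases eq_or_ne z 1 with rfl | h1
    · exact tendsto_stripIncrement_one hΦ
    have h1' : z - 1 ≠ 0 := sub_ne_zero.2 h1
    -- `(z - 1) Φ + integrand z` is a primitive of the integrand for `z - 1`.
    have hΨ : ∀ w, HasDerivAt (fun w => (z - 1) * Φ w + integrand z w) (integrand (z - 1) w) w :=
      fun w => by
        have h2 := hasDerivAt_integrand_add_one (z - 1) w
        rw [sub_add_cancel] at h2
        exact (((hΦ w).const_mul (z - 1)).add h2).congr_deriv (by ring)
    have h3 := ih (z := z - 1) (by push_cast at hz; simp; linarith) hΨ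
    have h4 := ((h3.sub (tendsto_stripIncrement_integrand z)).const_mul (z - 1)⁻¹)
    refine (h4.congr fun x => ?_).trans (le_of_eq ?_)
    · simp only [stripIncrement]
      field_simp
      ring
    -- The functional equation for 1/Γ holds at the poles of Γ too, so no further case is excluded.
    · have h5 := Complex.one_div_Gamma_eq_self_mul_one_div_Gamma_add_one (z - 1)
      rw [sub_add_cancel] at h5
      rw [h5]
      congr 1
      field_simp
      ring

theorem tendsto_stripIncrement {z : ℂ} {Φ : ℂ → ℂ} (hΦ : ∀ w, HasDerivAt Φ (integrand z w) w) :
    Tendsto (stripIncrement Φ) atTop (𝓝 (2 * Real.pi * Complex.I * (Complex.Gamma z)⁻¹)) := by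
  obtain ⟨n, hn⟩ := exists_nat_gt z.re
  exact tendsto_stripIncrement_of_re_lt n (by linarith) hΦ

/-- **Hankel's formula**, for the increments of a primitive along a curve `w` that goes from
`+∞ - π i` to `+∞ + π i`. -/
theorem tendsto_primitive_sub {z : ℂ} {Φ : ℂ → ℂ} (hΦ : ∀ w, HasDerivAt Φ (integrand z w) w)
    {w : ℝ → ℂ} (hre_bot : Tendsto (fun t => (w t).re) atBot atTop)
    (hre_top : Tendsto (fun t => (w t).re) atTop atTop)
    (him_bot : Tendsto (fun t => (w t).im) atBot (𝓝 (-Real.pi)))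
    (him_top : Tendsto (fun t => (w t).im) atTop (𝓝 Real.pi)) :
    Tendsto (fun p : ℝ × ℝ => Φ (w p.2) - Φ (w p.1)) (atBot ×ˢ atTop)
      (𝓝 (2 * Real.pi * Complex.I * (Complex.Gamma z)⁻¹)) := by
  obtain ⟨L, hL⟩ := exists_tendsto_horizontal hΦ abs_pi
  obtain ⟨L', hL'⟩ := exists_tendsto_horizontal hΦ abs_neg_pi
  -- The edge limits depend on the choice of Φ; only their difference is determined.
  rw [tendsto_nhds_unique (tendsto_stripIncrement hΦ) (hL.sub hL')]
  exact ((tendsto_of_tendsto_horizontal hΦ abs_pi hL hre_top him_top).comp tendsto_snd).sub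
    ((tendsto_of_tendsto_horizontal hΦ abs_neg_pi hL' hre_bot him_bot).comp tendsto_fst)

end HankelContour

namespace CayleyDickson

variable {v : ℕ}

/-! ### Algebraic identities -/

theorem ext_components {x y : CayleyDickson (v + 1)}
    (h₁ : (WithLp.ofLp x).1 = (WithLp.ofLp y).1) (h₂ : (WithLp.ofLp x).2 = (WithLp.ofLp y).2) :
    x = y :=
  (WithLp.equiv 2 (CayleyDickson v × CayleyDickson v)).injective (Prod.ext h₁ h₂)

theorem star_add' (x y : CayleyDickson v) : star (x + y) = star x + star y := by
  induction v with
  | zero => rfl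
  | succ v ih =>
    refine ext_components (ih _ _) ?_
    change -((WithLp.ofLp x).2 + (WithLp.ofLp y).2) = -(WithLp.ofLp x).2 + -(WithLp.ofLp y).2
    abel

theorem star_smul' (r : ℝ) (x : CayleyDickson v) : star (r • x) = r • star x := by
  induction v with
  | zero => rfl
  | succ v ih =>
    refine ext_components (ih _) ?_
    change -(r • (WithLp.ofLp x).2) = r • -(WithLp.ofLp x).2
    rw [smul_neg]

theorem mul_fst (x y : CayleyDickson (v + 1)) : (WithLp.ofLp (x * y)).1 =
    (WithLp.ofLp x).1 * (WithLp.ofLp y).1 - star (WithLp.ofLp y).2 * (WithLp.ofLp x).2 := rfl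

theorem mul_snd (x y : CayleyDickson (v + 1)) : (WithLp.ofLp (x * y)).2 =
    (WithLp.ofLp y).2 * (WithLp.ofLp x).1 + (WithLp.ofLp x).2 * star (WithLp.ofLp y).1 := rfl

theorem ofLp_add_fst (x y : CayleyDickson (v + 1)) :
    (WithLp.ofLp (x + y)).1 = (WithLp.ofLp x).1 + (WithLp.ofLp y).1 := rfl

theorem ofLp_add_snd (x y : CayleyDickson (v + 1)) :
    (WithLp.ofLp (x + y)).2 = (WithLp.ofLp x).2 + (WithLp.ofLp y).2 := rfl

theorem ofLp_smul_fst (r : ℝ) (x : CayleyDickson (v + 1)) :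
    (WithLp.ofLp (r • x)).1 = r • (WithLp.ofLp x).1 := rfl

theorem ofLp_smul_snd (r : ℝ) (x : CayleyDickson (v + 1)) :
    (WithLp.ofLp (r • x)).2 = r • (WithLp.ofLp x).2 := rfl

theorem star_fst (x : CayleyDickson (v + 1)) :
    (WithLp.ofLp (Star.star (R := CayleyDickson (v + 1)) x)).1 = star (WithLp.ofLp x).1 := rfl

theorem star_snd (x : CayleyDickson (v + 1)) :
    (WithLp.ofLp (Star.star (R := CayleyDickson (v + 1)) x)).2 = -(WithLp.ofLp x).2 := rfl

theorem one_fst : (WithLp.ofLp (1 : CayleyDickson (v + 1))).1 = 1 := rfl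

theorem one_snd : (WithLp.ofLp (1 : CayleyDickson (v + 1))).2 = 0 := rfl

/-- Doubling swaps the order of some factors, so each distributive law needs both laws one level
below. -/
theorem mul_add_and_add_mul (x y z : CayleyDickson v) :
    x * (y + z) = x * y + x * z ∧ (x + y) * z = x * z + y * z := by
  induction v with
  | zero => exact ⟨mul_add (R := ℝ) x y z, add_mul (R := ℝ) x y z⟩
  | succ v ih =>
    have h1 := fun x y z => (ih x y z).1
    have h2 := fun x y z => (ih x y z).2
    constructor <;> refine ext_components ?_ ?_ <;>
      simp only [mul_fst, mul_snd, ofLp_add_fst, ofLp_add_snd, star_add', h1, h2] <;> abel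

theorem mul_add' (x y z : CayleyDickson v) : x * (y + z) = x * y + x * z :=
  (mul_add_and_add_mul x y z).1

theorem add_mul' (x y z : CayleyDickson v) : (x + y) * z = x * z + y * z :=
  (mul_add_and_add_mul x y z).2

theorem mul_smul_and_smul_mul (r : ℝ) (x y : CayleyDickson v) :
    x * (r • y) = r • (x * y) ∧ (r • x) * y = r • (x * y) := by
  induction v with
  | zero => exact ⟨mul_left_comm (G := ℝ) x r y, mul_assoc (G := ℝ) r x y⟩
  | succ v ih =>
    have h1 := fun x y => (ih x y).1
    have h2 := fun x y => (ih x y).2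
    constructor <;> refine ext_components ?_ ?_ <;>
      simp only [mul_fst, mul_snd, ofLp_smul_fst, ofLp_smul_snd, star_smul', h1, h2, smul_sub,
        smul_add]

theorem mul_smul' (r : ℝ) (x y : CayleyDickson v) : x * (r • y) = r • (x * y) :=
  (mul_smul_and_smul_mul r x y).1

theorem smul_mul' (r : ℝ) (x y : CayleyDickson v) : (r • x) * y = r • (x * y) :=
  (mul_smul_and_smul_mul r x y).2

theorem mul_zero' (x : CayleyDickson v) : x * 0 = 0 := by
  simpa using mul_smul' 0 x 0

theorem zero_mul' (x : CayleyDickson v) : 0 * x = 0 := by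
  simpa using smul_mul' 0 0 x

theorem neg_mul' (x y : CayleyDickson v) : -x * y = -(x * y) := by
  rw [← neg_one_smul ℝ x, smul_mul', neg_one_smul]

theorem mul_neg' (x y : CayleyDickson v) : x * -y = -(x * y) := by
  rw [← neg_one_smul ℝ y, mul_smul', neg_one_smul]

theorem star_zero' : star (0 : CayleyDickson v) = 0 := by
  simpa using star_smul' 0 (0 : CayleyDickson v)

theorem star_one' : star (1 : CayleyDickson v) = 1 := by
  induction v with
  | zero => rfl
  | succ v ih => exact ext_components ih (neg_zero (G := CayleyDickson v))

theorem mul_one_and_one_mul (x : CayleyDickson v) : x * 1 = x ∧ 1 * x = x := by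
  induction v with
  | zero => exact ⟨mul_one (M := ℝ) x, one_mul (M := ℝ) x⟩
  | succ v ih =>
    have h1 := fun x => (ih x).1
    have h2 := fun x => (ih x).2
    constructor <;> refine ext_components ?_ ?_ <;>
      simp [mul_fst, mul_snd, one_fst, one_snd, star_one', star_zero', zero_mul', mul_zero', h1, h2]

theorem mul_one' (x : CayleyDickson v) : x * 1 = x := (mul_one_and_one_mul x).1

theorem one_mul' (x : CayleyDickson v) : 1 * x = x := (mul_one_and_one_mul x).2

theorem norm_sq_succ (x : CayleyDickson (v + 1)) :
    ‖x‖ ^ 2 = ‖(WithLp.ofLp x).1‖ ^ 2 + ‖(WithLp.ofLp x).2‖ ^ 2 :=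
  WithLp.prod_norm_sq_eq_of_L2 (α := CayleyDickson v) (β := CayleyDickson v) x

/-- In star x * x the second component cancels and the first is a sum of two products of the same
kind, so the induction needs no associativity. Both M² = -1 and the isometry of ℂ with the plane
follow from this identity. -/
theorem star_mul_self_eq (x : CayleyDickson v) : star x * x = ‖x‖ ^ 2 • (1 : CayleyDickson v) := by
  induction v with
  | zero =>
    change (show ℝ from x) * (show ℝ from x) = ‖(show ℝ from x)‖ ^ 2 * 1
    rw [mul_one, Real.norm_eq_abs, sq_abs, sq]
  | succ v ih =>
    refine ext_components ?_ ?_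
    · rw [mul_fst, star_fst, star_snd, mul_neg', sub_neg_eq_add, ih, ih, norm_sq_succ,
        ofLp_smul_fst, one_fst, add_smul]
    · rw [mul_snd, star_fst, star_snd, neg_mul', add_neg_cancel, ofLp_smul_snd, one_snd, smul_zero]

theorem norm_one' : ‖(1 : CayleyDickson v)‖ = 1 := by
  induction v with
  | zero => exact norm_one (α := ℝ)
  | succ v ih =>
    have h := norm_sq_succ (1 : CayleyDickson (v + 1))
    rw [one_fst, one_snd, ih, norm_zero] at h
    nlinarith [norm_nonneg (1 : CayleyDickson (v + 1))]

theorem one_ne_zero' : (1 : CayleyDickson v) ≠ 0 := by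
  rw [← norm_ne_zero_iff, norm_one']; exact one_ne_zero

theorem re_add (x y : CayleyDickson v) : re v (x + y) = re v x + re v y := by
  induction v with
  | zero => rfl
  | succ v ih => exact ih _ _

theorem re_smul (r : ℝ) (x : CayleyDickson v) : re v (r • x) = r * re v x := by
  induction v with
  | zero => rfl
  | succ v ih => exact ih _

theorem re_one : re v 1 = 1 := by
  induction v with
  | zero => rfl
  | succ v ih => exact ih

/-! ### The planes `ℝ ⊕ Mℝ` -/

variable {M : CayleyDickson v}

theorem IsImaginaryUnit.star_eq (hM : IsImaginaryUnit M) : star M = -M := by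
  have h := half_smul_add_star M
  rw [hM.1, zero_smul, smul_eq_zero] at h
  exact eq_neg_of_add_eq_zero_right (h.resolve_left (by norm_num))

theorem IsImaginaryUnit.mul_self (hM : IsImaginaryUnit M) : M * M = -1 := by
  have h := star_mul_self_eq M
  rw [hM.star_eq, hM.2, neg_mul', one_pow, one_smul] at h
  rw [← h, neg_neg]

theorem ofPlane_add (a b : ℂ) : ofPlane M (a + b) = ofPlane M a + ofPlane M b := by
  simp only [ofPlane, Complex.add_re, Complex.add_im]
  module

theorem ofPlane_smul (r : ℝ) (a : ℂ) : ofPlane M (r • a) = r • ofPlane M a := by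
  simp only [ofPlane, Complex.smul_re, Complex.smul_im, smul_eq_mul]
  module

theorem ofPlane_neg (a : ℂ) : ofPlane M (-a) = -ofPlane M a := by
  rw [← neg_one_smul ℝ a, ofPlane_smul, neg_one_smul]

theorem ofPlane_sub (a b : ℂ) : ofPlane M (a - b) = ofPlane M a - ofPlane M b := by
  rw [sub_eq_add_neg, ofPlane_add, ofPlane_neg, sub_eq_add_neg]

theorem ofPlane_one : ofPlane M 1 = 1 := by simp [ofPlane]

theorem ofPlane_ofReal (r : ℝ) : ofPlane M r = r • (1 : CayleyDickson v) := by simp [ofPlane]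

theorem ofPlane_conj (w : ℂ) : ofPlane M (starRingEnd ℂ w) = ofPlane (-M) w := by
  simp [ofPlane]

theorem ofPlane_mul (hM : IsImaginaryUnit M) (a b : ℂ) :
    ofPlane M (a * b) = ofPlane M a * ofPlane M b := by
  simp only [ofPlane, mul_add', add_mul', mul_smul', smul_mul', mul_one', one_mul', hM.mul_self,
    Complex.mul_re, Complex.mul_im]
  module

theorem star_ofPlane (hM : IsImaginaryUnit M) (w : ℂ) :
    star (ofPlane M w) = ofPlane M (starRingEnd ℂ w) := by
  simp [ofPlane, star_add', star_smul', star_one', hM.star_eq]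

theorem re_ofPlane (hM : IsImaginaryUnit M) (w : ℂ) : re v (ofPlane M w) = w.re := by
  rw [ofPlane, re_add, re_smul, re_smul, re_one, hM.1, mul_one, mul_zero, add_zero]

theorem norm_ofPlane (hM : IsImaginaryUnit M) (w : ℂ) : ‖ofPlane M w‖ = ‖w‖ := by
  have h := star_mul_self_eq (ofPlane M w)
  rw [star_ofPlane hM, ← ofPlane_mul hM, Complex.conj_mul', ← Complex.ofReal_pow,
    ofPlane_ofReal] at h
  have h' := smul_left_injective ℝ one_ne_zero' h
  exact ((sq_eq_sq₀ (norm_nonneg _) (norm_nonneg _)).1 h').symm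

/-- The isometric embedding of `ℂ` onto the plane `ℝ ⊕ Mℝ`. -/
noncomputable def ofPlaneLI (hM : IsImaginaryUnit M) : ℂ →ₗᵢ[ℝ] CayleyDickson v where
  toFun := ofPlane M
  map_add' := ofPlane_add
  map_smul' := ofPlane_smul
  norm_map' := norm_ofPlane hM

theorem ofPlaneLI_apply (hM : IsImaginaryUnit M) (w : ℂ) : ofPlaneLI hM w = ofPlane M w := rfl

theorem ofPlane_injective (hM : IsImaginaryUnit M) : Function.Injective (ofPlane M) :=
  (ofPlaneLI hM).injective

theorem ofPlane_I : ofPlane M Complex.I = M := by simp [ofPlane]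

theorem pow_ofPlane (hM : IsImaginaryUnit M) (w : ℂ) (n : ℕ) :
    pow (ofPlane M w) n = ofPlane M (w ^ n) := by
  induction n with
  | zero => rw [pow_zero, ofPlane_one, pow]
  | succ n ih => rw [pow, ih, pow_succ, ofPlane_mul hM]

theorem exp_ofPlane (hM : IsImaginaryUnit M) (w : ℂ) :
    exp (ofPlane M w) = ofPlane M (Complex.exp w) := by
  have h : HasSum (fun n : ℕ => ((n.factorial : ℝ)⁻¹) • w ^ n) (Complex.exp w) := by
    rw [Complex.exp_eq_exp_ℂ]
    exact NormedSpace.exp_series_hasSum_exp' (𝕂 := ℝ) w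
  have h' := h.mapL (ofPlaneLI hM).toContinuousLinearMap
  rw [exp, ← ofPlaneLI_apply hM (Complex.exp w), ← LinearIsometry.coe_toContinuousLinearMap, ← h'.tsum_eq]
  refine tsum_congr fun n => ?_
  rw [pow_ofPlane hM, map_smul]
  rfl

theorem inv_ofPlane (hM : IsImaginaryUnit M) (w : ℂ) : (ofPlane M w)⁻¹ = ofPlane M w⁻¹ := by
  change (‖ofPlane M w‖ ^ 2)⁻¹ • star (ofPlane M w) = _
  rw [norm_ofPlane hM, star_ofPlane hM, ← ofPlane_smul, Complex.inv_def, Complex.normSq_eq_norm_sq,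
    Complex.real_smul, mul_comm]

theorem isNonposInt_ofPlane_iff (hM : IsImaginaryUnit M) (w : ℂ) :
    IsNonposInt (ofPlane M w) ↔ ∃ n : ℕ, w = -(n : ℂ) := by
  refine exists_congr fun n => ?_
  rw [← ofPlane_ofReal (M := M), (ofPlane_injective hM).eq_iff]
  push_cast
  rfl

/-- Every element lies in a plane `ℝ ⊕ Nℝ`. -/
theorem exists_eq_ofPlane (hM : IsImaginaryUnit M) (x : CayleyDickson v) :
    ∃ N : CayleyDickson v, IsImaginaryUnit N ∧ ∃ w : ℂ, x = ofPlane N w := by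
  set y := x - re v x • (1 : CayleyDickson v) with hy
  rcases eq_or_ne y 0 with h0 | h0
  -- A real x lies in every plane, so the given unit serves.
  · exact ⟨M, hM, re v x, by rw [ofPlane_ofReal, ← sub_eq_zero, ← hy, h0]⟩
  · have hn : ‖y‖ ≠ 0 := norm_ne_zero_iff.2 h0
    refine ⟨‖y‖⁻¹ • y, ⟨?_, ?_⟩, ⟨re v x, ‖y‖⟩, ?_⟩
    · rw [re_smul, hy, sub_eq_add_neg, ← neg_smul, re_add, re_smul, re_one]
      ring
    · rw [norm_smul, norm_inv, norm_norm, inv_mul_cancel₀ hn]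
    · rw [ofPlane, smul_smul, mul_inv_cancel₀ hn, one_smul, hy]
      abel

/-- Two planes meet in the real axis only, unless they agree up to conjugation. -/
theorem eq_or_eq_conj_of_ofPlane_eq {N : CayleyDickson v} (hM : IsImaginaryUnit M)
    (hN : IsImaginaryUnit N) {a b : ℂ} (h : ofPlane M a = ofPlane N b) :
    (a = b ∧ (a.im = 0 ∨ M = N)) ∨ (a = starRingEnd ℂ b ∧ M = -N) := by
  have hre : a.re = b.re := by rw [← re_ofPlane hM, h, re_ofPlane hN]
  have him : a.im • M = b.im • N := by
    rw [ofPlane, ofPlane, hre] at h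
    exact add_left_cancel h
  have habs : |a.im| = |b.im| := by
    have := congrArg norm him
    rwa [norm_smul, norm_smul, hM.2, hN.2, mul_one, mul_one] at this
  rcases eq_or_ne a.im 0 with h0 | h0
  · rw [h0, abs_zero, eq_comm, abs_eq_zero] at habs
    exact Or.inl ⟨Complex.ext hre (h0.trans habs.symm), Or.inl h0⟩
  · rcases abs_eq_abs.1 habs with h1 | h1
    · rw [← h1] at him
      exact Or.inl ⟨Complex.ext hre h1, Or.inr (smul_right_injective _ h0 him)⟩
    · have h2 : b.im = -a.im := by rw [h1, neg_neg]
      rw [h2, neg_smul, ← smul_neg] at him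
      exact Or.inr ⟨Complex.ext hre h1, smul_right_injective _ h0 him⟩

/-! ### The Gamma function -/

/-- Complex Γ is real on the real axis and commutes with conjugation, so its copies in different
planes glue to one function. -/
theorem ofPlane_gamma_eq_of_ofPlane_eq {N : CayleyDickson v} (hM : IsImaginaryUnit M)
    (hN : IsImaginaryUnit N) {a b : ℂ} (h : ofPlane M a = ofPlane N b) :
    ofPlane M (Complex.Gamma a) = ofPlane N (Complex.Gamma b) := by
  rcases eq_or_eq_conj_of_ofPlane_eq hM hN h with ⟨rfl, h0 | rfl⟩ | ⟨rfl, rfl⟩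
  · have e : Complex.Gamma a = (Real.Gamma a.re : ℝ) := by
      rw [← Complex.Gamma_ofReal]
      congr 1
      exact Complex.ext rfl (by simpa using h0)
    rw [e, ofPlane_ofReal, ofPlane_ofReal]
  · rfl
  · rw [Complex.Gamma_conj, ofPlane_conj, neg_neg]

theorem eulerIntegral_ofPlane (hM : IsImaginaryUnit M) {w : ℂ} (hw : 0 < w.re) :
    eulerIntegral (ofPlane M w) = ofPlane M (Complex.Gamma w) := by
  rw [Complex.Gamma_eq_integral hw, Complex.GammaIntegral,
    ← ofPlaneLI_apply hM (∫ t in Set.Ioi (0 : ℝ), _),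
    ← LinearIsometry.coe_toContinuousLinearMap,
    ← ContinuousLinearMap.integral_comp_comm _ (Complex.GammaIntegral_convergent hw),
    eulerIntegral]
  refine setIntegral_congr_fun measurableSet_Ioi fun t ht => ?_
  have ht' : (t : ℂ) ≠ 0 := by exact_mod_cast (Set.mem_Ioi.1 ht).ne'
  have e : Real.log t • (ofPlane M w - 1) = ofPlane M (Complex.log t * (w - 1)) := by
    rw [← ofPlane_one (M := M), ← ofPlane_sub, ← ofPlane_smul, Complex.real_smul,
      Complex.ofReal_log (Set.mem_Ioi.1 ht).le]
  change Real.exp (-t) • exp (Real.log t • (ofPlane M w - 1)) =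
    ofPlane M (Real.exp (-t) * (t : ℂ) ^ (w - 1))
  rw [e, exp_ofPlane hM, ← ofPlane_smul, Complex.real_smul, Complex.cpow_def_of_ne_zero ht']

/-- `Gamma` is a choice by `Classical.epsilon`, which has the defining property only once some
function is known to have it. -/
theorem exists_isGammaFunction (hM : IsImaginaryUnit M) :
    ∃ G : CayleyDickson v → CayleyDickson v, IsGammaFunction G := by
  choose N hN w hw using exists_eq_ofPlane hM
  have key : ∀ (K : CayleyDickson v), IsImaginaryUnit K → ∀ a : ℂ,
      ofPlane (N (ofPlane K a)) (Complex.Gamma (w (ofPlane K a))) = ofPlane K (Complex.Gamma a) :=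
    fun K hK a => ofPlane_gamma_eq_of_ofPlane_eq (hN _) hK (hw _).symm
  refine ⟨fun x => ofPlane (N x) (Complex.Gamma (w x)), fun z hz => ?_, fun K hK => ?_⟩
  · have hz' := hw z
    rw [hz', re_ofPlane (hN z)] at hz
    conv_rhs => rw [hz']
    exact (eulerIntegral_ofPlane (hN z) hz).symm
  · exact ⟨Complex.Gamma, fun a ha => (Complex.differentiableAt_Gamma a ha).differentiableWithinAt,
      fun a _ => key K hK a⟩

theorem isPreconnected_compl_nonposInt : IsPreconnected {w : ℂ | ∀ n : ℕ, w ≠ -(n : ℂ)} := by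
  have h := (Set.countable_range fun n : ℕ => -(n : ℂ)).isPathConnected_compl_of_one_lt_rank
    (by rw [Complex.rank_real_complex]; norm_num)
  convert h.isConnected.isPreconnected using 1
  ext w
  simp [eq_comm]

theorem isOpen_compl_nonposInt : IsOpen {w : ℂ | ∀ n : ℕ, w ≠ -(n : ℂ)} := by
  have h : IsClosed (Set.range fun n : ℕ => -(n : ℂ)) := by
    have h1 := Complex.isClosedEmbedding_intCast.isClosedMap
      (Set.range fun n : ℕ => -(n : ℤ)) (isClosed_discrete _)
    rw [← Set.range_comp] at h1
    convert h1 using 2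
    ext n
    simp
  convert h.isOpen_compl using 1
  ext w
  simp [eq_comm]

theorem IsGammaFunction.ofPlane_eq {G : CayleyDickson v → CayleyDickson v}
    (hG : IsGammaFunction G) (hM : IsImaginaryUnit M) {w : ℂ} (hw : ∀ n : ℕ, w ≠ -(n : ℂ)) :
    G (ofPlane M w) = ofPlane M (Complex.Gamma w) := by
  obtain ⟨g, hg, hGg⟩ := hG.2 M hM
  have hpos : ∀ u : ℂ, 0 < u.re → ∀ n : ℕ, u ≠ -(n : ℂ) := by
    rintro u hu n rfl
    simp only [Complex.neg_re, Complex.natCast_re, Left.neg_pos_iff] at hu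
    exact absurd hu (not_lt.2 n.cast_nonneg)
  have heq : ∀ u : ℂ, 0 < u.re → g u = Complex.Gamma u := fun u hu => by
    refine ofPlane_injective hM ?_
    rw [← hGg u (hpos u hu), hG.1 _ (by rwa [re_ofPlane hM]), eulerIntegral_ofPlane hM hu]
  have hΓ : DifferentiableOn ℂ Complex.Gamma {w : ℂ | ∀ n : ℕ, w ≠ -(n : ℂ)} := fun a ha =>
    (Complex.differentiableAt_Gamma a ha).differentiableWithinAt
  have hev : g =ᶠ[𝓝 1] Complex.Gamma := by
    filter_upwards [(isOpen_lt continuous_const Complex.continuous_re).mem_nhds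
      (show (0 : ℝ) < (1 : ℂ).re by simp)] with u hu using heq u hu
  -- Identity theorem: g agrees with Γ near 1, and ℂ minus the poles is open and connected.
  rw [hGg w hw, (hg.analyticOnNhd isOpen_compl_nonposInt).eqOn_of_preconnected_of_eventuallyEq
    (hΓ.analyticOnNhd isOpen_compl_nonposInt) isPreconnected_compl_nonposInt
    (hpos 1 (by simp)) hev hw]

theorem gamma_ofPlane (hM : IsImaginaryUnit M) {w : ℂ} (hw : ∀ n : ℕ, w ≠ -(n : ℂ)) :
    Gamma (ofPlane M w) = ofPlane M (Complex.Gamma w) :=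
  IsGammaFunction.ofPlane_eq (Classical.epsilon_spec (exists_isGammaFunction hM)) hM hw

theorem recipGamma_ofPlane (hM : IsImaginaryUnit M) (w : ℂ) :
    recipGamma (ofPlane M w) = ofPlane M (Complex.Gamma w)⁻¹ := by
  rw [recipGamma]
  split_ifs with h
  -- At its poles `Complex.Gamma` has the default value 0, whose inverse is again 0, in agreement
  -- with 1/Γ.
  · rw [(Complex.Gamma_eq_zero_iff w).2 ((isNonposInt_ofPlane_iff hM w).1 h), inv_zero]
    simp [ofPlane]
  · rw [isNonposInt_ofPlane_iff hM] at h
    rw [gamma_ofPlane hM (not_exists.1 h), inv_ofPlane hM]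

/-! ### Hankel's integral -/

/-- The logarithm `ln |ψ t| + i θ t` along a Hankel loop, as a complex number. -/
noncomputable def logCurve (ψ : ℝ → CayleyDickson v) (θ : ℝ → ℝ) (t : ℝ) : ℂ :=
  Real.log ‖ψ t‖ + θ t * Complex.I

theorem ofPlane_logCurve (ψ : ℝ → CayleyDickson v) (θ : ℝ → ℝ) (t : ℝ) :
    ofPlane M (logCurve ψ θ t) = logArg M (ψ t) (θ t) := by
  simp [ofPlane, logCurve, logArg]

namespace IsHankelLoop

variable {ψ : ℝ → CayleyDickson v} {θ : ℝ → ℝ}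

theorem eq_ofPlane (hψ : IsHankelLoop M ψ θ) (t : ℝ) :
    ψ t = ofPlane M (Complex.exp (logCurve ψ θ t)) := by
  rw [logCurve, Complex.exp_add, ← Complex.ofReal_exp,
    Real.exp_log (norm_pos_iff.2 (hψ.ne_zero t)), ← Complex.real_smul, ofPlane_smul]
  exact hψ.polar t

theorem continuous_logCurve (hψ : IsHankelLoop M ψ θ) : Continuous (logCurve ψ θ) :=
  (Complex.continuous_ofReal.comp
    (hψ.continuous.norm.log fun t => norm_ne_zero_iff.2 (hψ.ne_zero t))).add
    ((Complex.continuous_ofReal.comp hψ.continuous_arg).mul continuous_const)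

theorem locallyBoundedVariationOn (hψ : IsHankelLoop M ψ θ) (hM : IsImaginaryUnit M) :
    LocallyBoundedVariationOn (fun t => Complex.exp (logCurve ψ θ t)) Set.univ := by
  intro a b ha hb
  have h := hψ.rectifiable a b ha hb
  rw [BoundedVariationOn, eVariationOn] at h ⊢
  simpa only [hψ.eq_ofPlane, ← ofPlaneLI_apply hM, (ofPlaneLI hM).isometry.edist_eq] using h

end IsHankelLoop

end CayleyDickson

namespace CayleyDickson.IsHankelLoop

variable {v : ℕ} {M : CayleyDickson v} {ψ : ℝ → CayleyDickson v} {θ : ℝ → ℝ}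

theorem integrand_eq_ofPlane (hψ : IsHankelLoop M ψ θ) (hM : IsImaginaryUnit M) (c : ℂ) (t : ℝ) :
    exp (ψ t) * exp (-(ofPlane M c * logArg M (ψ t) (θ t))) =
      ofPlane M (Complex.exp (Complex.exp (logCurve ψ θ t)) *
        Complex.exp (-(c * logCurve ψ θ t))) := by
  rw [← ofPlane_logCurve, ← ofPlane_mul hM, ← ofPlane_neg, exp_ofPlane hM, hψ.eq_ofPlane t,
    exp_ofPlane hM, ofPlane_mul hM]

theorem hasLineIntegral (hψ : IsHankelLoop M ψ θ) (hM : IsImaginaryUnit M) {c : ℂ} {Φ : ℂ → ℂ}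
    (hΦ : ∀ w, HasDerivAt Φ (HankelContour.integrand c w) w) (a b : ℝ) :
    HasLineIntegral (fun t => exp (ψ t) * exp (-(ofPlane M c * logArg M (ψ t) (θ t)))) ψ a b
      (ofPlane M (Φ (logCurve ψ θ b) - Φ (logCurve ψ θ a))) := by
  intro ε hε
  obtain ⟨δ, hδ, H⟩ := HankelContour.exists_forall_norm_sum_sub_lt
    (f := fun w => Complex.exp (Complex.exp w) * Complex.exp (-(c * w))) (by fun_prop)
    (fun w => (hΦ w).congr_deriv (HankelContour.integrand_eq_mul_exp c w))
    hψ.continuous_logCurve (hψ.locallyBoundedVariationOn hM) a b hε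
  refine ⟨δ, hδ, fun n t τ h0 hn ht => ?_⟩
  have h := H n t τ h0 hn ht
  rw [← norm_ofPlane hM, ofPlane_sub, ← ofPlaneLI_apply hM (∑ k ∈ _, _), map_sum] at h
  refine lt_of_eq_of_lt (congrArg norm (congrArg (· - _) (Finset.sum_congr rfl fun k _ => ?_))) h
  beta_reduce
  rw [hψ.integrand_eq_ofPlane hM, ofPlaneLI_apply, ofPlane_mul hM _ (_ - _), ofPlane_sub,
    ← hψ.eq_ofPlane, ← hψ.eq_ofPlane]

theorem hasImproperLineIntegral (hψ : IsHankelLoop M ψ θ) (hM : IsImaginaryUnit M) (c : ℂ) :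
    HasImproperLineIntegral
      (fun t => exp (ψ t) * exp (-(ofPlane M c * logArg M (ψ t) (θ t)))) ψ
      (ofPlane M (2 * Real.pi * Complex.I * (Complex.Gamma c)⁻¹)) := by
  obtain ⟨Φ, hΦ⟩ := HankelContour.exists_primitive c
  refine ⟨fun a b => ofPlane M (Φ (logCurve ψ θ b) - Φ (logCurve ψ θ a)),
    fun a b _ => hψ.hasLineIntegral hM hΦ a b, ?_⟩
  have hre : ∀ t, (logCurve ψ θ t).re = Real.log ‖ψ t‖ := fun t =>
    HankelContour.ofReal_add_mul_I_re _ _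
  have him : ∀ t, (logCurve ψ θ t).im = θ t := fun t => HankelContour.ofReal_add_mul_I_im _ _
  refine ((ofPlaneLI hM).continuous.tendsto _).comp
    (HankelContour.tendsto_primitive_sub hΦ ?_ ?_ ?_ ?_)
  · simp only [hre]
    exact Real.tendsto_log_atTop.comp hψ.norm_start
  · simp only [hre]
    exact Real.tendsto_log_atTop.comp hψ.norm_end
  · simpa only [him] using hψ.arg_start
  · simpa only [him] using hψ.arg_end

end CayleyDickson.IsHankelLoop

theorem proposition12 (v : ℕ) (hv : 1 ≤ v) (M : CayleyDickson v)
    (hM : CayleyDickson.IsImaginaryUnit M)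
    (z : CayleyDickson v) (hz : z ∈ CayleyDickson.plane M)
    (ψ : ℝ → CayleyDickson v) (θ : ℝ → ℝ) (hψ : CayleyDickson.IsHankelLoop M ψ θ) :
    (¬ CayleyDickson.IsNonposInt z → CayleyDickson.Gamma z ≠ 0) ∧
    ∃ I : CayleyDickson v,
      CayleyDickson.HasImproperLineIntegral
        (fun t => CayleyDickson.exp (ψ t) *
          CayleyDickson.exp (-(z * CayleyDickson.logArg M (ψ t) (θ t)))) ψ I ∧
      CayleyDickson.recipGamma z = (2 * Real.pi)⁻¹ • (I * star M) := by
  obtain ⟨c, rfl⟩ := hz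
  refine ⟨fun hc => ?_, _, hψ.hasImproperLineIntegral hM c, ?_⟩
  · rw [CayleyDickson.isNonposInt_ofPlane_iff hM, not_exists] at hc
    rw [CayleyDickson.gamma_ofPlane hM hc, ← norm_ne_zero_iff, CayleyDickson.norm_ofPlane hM,
      norm_ne_zero_iff]
    exact Complex.Gamma_ne_zero hc
  -- M* corresponds to -i and cancels the factor i of 2πi/Γ.
  · have hs : star M = CayleyDickson.ofPlane M (-Complex.I) := by
      rw [hM.star_eq, CayleyDickson.ofPlane_neg, CayleyDickson.ofPlane_I]
    rw [CayleyDickson.recipGamma_ofPlane hM, hs, ← CayleyDickson.ofPlane_mul hM,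
      ← CayleyDickson.ofPlane_smul, Complex.real_smul]
    congr 1
    have hpi : (Real.pi : ℂ) ≠ 0 := by exact_mod_cast Real.pi_ne_zero
    push_cast
    field_simp
    linear_combination (Complex.Gamma c)⁻¹ * Complex.I_sq
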